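/- Let $(S,\mathcal F,\mu)$ be any probability space and let $1\le p<\infty$. For a $\mu$-integrable function $h\colon S\to\mathbb R$ write $\mathbb E h=\int_S h\,d\mu$, write $\|h\|_p=\left(\int_S |h|^p\,d\mu\right)^{1/p}$, and let $\|h\|_\infty$ be the $\mu$-essential supremum of $|h|$. Then for all real-valued $f,g\in L^\infty(S,\mu)$, $$\|fg-\mathbb E(fg)\|_p\le \|g\|_\infty\,\|f-\mathbb E f\|_p+\|f\|_\infty\,\|g-\mathbb E g\|_p .$$ -/

import Mathlib

open MeasureTheory
open scoped ENNReal

/-!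
The product deviation splits symmetrically. With `F = f - 𝔼 f` and `G = g - 𝔼 g`,
`f g - 𝔼 (f g) = T g F + T f G`, where `T g F = (F g + F 𝔼 g - 𝔼 (F g)) / 2`.
It therefore suffices to show `‖T g F‖_p ≤ ‖g‖_∞ ‖F‖_p` for every `F` of mean zero, and by
homogeneity one may assume `|g| ≤ 1`.

Since `𝔼 F = 0`, the term `g(x) F(y) / 2` may be added under the integral, which gives
`T g F (x) = 𝔼_y [(g(x) + g(y)) / 2 * F(x) + (g(x) - g(y)) / 2 * F(y)]`.
The two weights satisfy `|g(x) + g(y)| / 2 + |g(x) - g(y)| / 2 = max |g(x)| |g(y)| ≤ 1`, so Jensen's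
inequality, applied to the integral and then to the two-term sum, bounds `|T g F (x)|^p` by
`𝔼_y [|g(x) + g(y)| / 2 * |F(x)|^p + |g(x) - g(y)| / 2 * |F(y)|^p]`.
After integrating in `x` and exchanging `x` and `y` in the second term, the weights recombine and the
bound is at most `𝔼 |F|^p`: this is `eLpNorm_symmetrized_mul_le_of_norm_le_one`.
-/

/-- Jensen's inequality for `z ↦ z ^ q` with subprobability weights: the missing mass is placed at
zero. -/
lemma ENNReal.add_mul_rpow_le_of_add_le_one {q : ℝ} (hq : 1 ≤ q) {a b : ℝ≥0∞} (hab : a + b ≤ 1)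
    (u v : ℝ≥0∞) : (a * u + b * v) ^ q ≤ a * u ^ q + b * v ^ q := by
  have h := ENNReal.rpow_arith_mean_le_arith_mean_rpow Finset.univ
    ![a, b, 1 - (a + b)] ![u, v, 0] (by
      simp [Fin.sum_univ_three, add_tsub_cancel_of_le hab]) hq
  simpa [Fin.sum_univ_three, ENNReal.zero_rpow_of_pos (zero_lt_one.trans_le hq)] using h

lemma enorm_half_add_add_enorm_half_sub_le_one {s t : ℝ} (hs : ‖s‖ ≤ 1) (ht : ‖t‖ ≤ 1) :
    ‖2⁻¹ * (s + t)‖ₑ + ‖2⁻¹ * (s - t)‖ₑ ≤ 1 := by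
  rw [Real.enorm_eq_ofReal_abs, Real.enorm_eq_ofReal_abs,
    ← ENNReal.ofReal_add (abs_nonneg _) (abs_nonneg _), ENNReal.ofReal_le_one]
  rw [Real.norm_eq_abs, abs_le] at hs ht
  rcases abs_cases (2⁻¹ * (s + t)) with h | h <;>
    rcases abs_cases (2⁻¹ * (s - t)) with h' | h' <;> linarith

lemma enorm_integral_rpow_le_lintegral_enorm_rpow {S : Type*} [MeasurableSpace S] {μ : Measure S}
    [IsProbabilityMeasure μ] {q : ℝ} (hq : 1 ≤ q) {k : S → ℝ} (hk : AEStronglyMeasurable k μ) :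
    ‖∫ y, k y ∂μ‖ₑ ^ q ≤ ∫⁻ y, ‖k y‖ₑ ^ q ∂μ := by
  have hq0 : 0 < q := zero_lt_one.trans_le hq
  have h := eLpNorm_le_eLpNorm_of_exponent_le (p := 1) (q := ENNReal.ofReal q) (by simpa) hk
  rw [eLpNorm_one_eq_lintegral_enorm, eLpNorm_eq_lintegral_rpow_enorm_toReal (by simpa) (by simp),
    ENNReal.toReal_ofReal hq0.le] at h
  calc ‖∫ y, k y ∂μ‖ₑ ^ q ≤ ((∫⁻ y, ‖k y‖ₑ ^ q ∂μ) ^ (1 / q)) ^ q := by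
        gcongr
        exact (enorm_integral_le_lintegral_enorm k).trans h
    _ = ∫⁻ y, ‖k y‖ₑ ^ q ∂μ := by
        rw [← ENNReal.rpow_mul, one_div_mul_cancel hq0.ne', ENNReal.rpow_one]

/-- The symmetrized product of a mean-zero function with a function bounded by one is contractive
in `L^p`. -/
lemma eLpNorm_symmetrized_mul_le_of_norm_le_one {S : Type*} [MeasurableSpace S] {μ : Measure S}
    [IsProbabilityMeasure μ] {p : ℝ≥0∞} (hp1 : 1 ≤ p) (hp : p ≠ ∞) {F g : S → ℝ}
    (hF : Integrable F μ) (hF0 : ∫ x, F x ∂μ = 0) (hg : AEStronglyMeasurable g μ)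
    (hg1 : ∀ᵐ x ∂μ, ‖g x‖ ≤ 1) :
    eLpNorm (fun x => 2⁻¹ * (F x * g x + F x * ∫ y, g y ∂μ - ∫ y, F y * g y ∂μ)) p μ ≤
      eLpNorm F p μ := by
  have hp0 : p ≠ 0 := (zero_lt_one.trans_le hp1).ne'
  have hq : 1 ≤ p.toReal := by simpa using ENNReal.toReal_mono hp hp1
  rw [eLpNorm_eq_lintegral_rpow_enorm_toReal hp0 hp, eLpNorm_eq_lintegral_rpow_enorm_toReal hp0 hp]
  set q := p.toReal
  gcongr ?_ ^ _
  have hgi : Integrable g μ := Integrable.of_bound hg 1 hg1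
  have hFg : Integrable (fun y => F y * g y) μ := hF.mul_bdd hg hg1
  have hφ : AEMeasurable (fun x => ‖F x‖ₑ ^ q) μ := hF.1.enorm.pow_const q
  have ha : AEMeasurable (fun z : S × S => ‖2⁻¹ * (g z.1 + g z.2)‖ₑ) (μ.prod μ) :=
    ((hg.comp_fst.add hg.comp_snd).const_mul _).enorm
  have hb : AEMeasurable (fun z : S × S => ‖2⁻¹ * (g z.1 - g z.2)‖ₑ) (μ.prod μ) :=
    ((hg.comp_fst.sub hg.comp_snd).const_mul _).enorm
  have hA : AEMeasurable (fun z : S × S => ‖2⁻¹ * (g z.1 + g z.2)‖ₑ * ‖F z.1‖ₑ ^ q) (μ.prod μ) :=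
    ha.mul hφ.comp_fst
  have hB : AEMeasurable (fun z : S × S => ‖2⁻¹ * (g z.1 - g z.2)‖ₑ * ‖F z.2‖ₑ ^ q) (μ.prod μ) :=
    hb.mul hφ.comp_snd
  have hA_fst : ∀ x, AEMeasurable (fun y => ‖2⁻¹ * (g x + g y)‖ₑ * ‖F x‖ₑ ^ q) μ := fun x =>
    ((aestronglyMeasurable_const.add hg).const_mul _).enorm.mul_const _
  calc ∫⁻ x, ‖2⁻¹ * (F x * g x + F x * ∫ y, g y ∂μ - ∫ y, F y * g y ∂μ)‖ₑ ^ q ∂μ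
      ≤ ∫⁻ x, ∫⁻ y, ‖2⁻¹ * (g x + g y)‖ₑ * ‖F x‖ₑ ^ q
          + ‖2⁻¹ * (g x - g y)‖ₑ * ‖F y‖ₑ ^ q ∂μ ∂μ := by
        refine lintegral_mono_ae ?_
        filter_upwards [hg1] with x hx
        have h1 : Integrable (fun y => 2⁻¹ * (F x * g x) + 2⁻¹ * F x * g y) μ :=
          (integrable_const _).add (hgi.const_mul _)
        have h2 : Integrable (fun y => 2⁻¹ * g x * F y - 2⁻¹ * (F y * g y)) μ :=
          (hF.const_mul _).sub (hFg.const_mul _)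
        -- `𝔼 F = 0` makes the extra term `g x * F y / 2` integrate to zero.
        have hker : 2⁻¹ * (F x * g x + F x * ∫ y, g y ∂μ - ∫ y, F y * g y ∂μ) =
            ∫ y, 2⁻¹ * (g x + g y) * F x + 2⁻¹ * (g x - g y) * F y ∂μ := by
          calc _ = ∫ y, (2⁻¹ * (F x * g x) + 2⁻¹ * F x * g y)
                + (2⁻¹ * g x * F y - 2⁻¹ * (F y * g y)) ∂μ := by
                rw [integral_add h1 h2, integral_add (integrable_const _) (hgi.const_mul _),
                  integral_sub (hF.const_mul _) (hFg.const_mul _),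
                  integral_const_mul _ F, integral_const_mul _ (fun y => F y * g y), hF0,
                  integral_const_mul _ g, integral_const]
                simp only [probReal_univ, smul_eq_mul]
                ring
            _ = _ := by congr 1; ext y; ring
        rw [hker]
        refine (enorm_integral_rpow_le_lintegral_enorm_rpow hq ?_).trans ?_
        · exact (((aestronglyMeasurable_const.add hg).const_mul _).mul_const _).add
            (((aestronglyMeasurable_const.sub hg).const_mul _).mul hF.1)
        · refine lintegral_mono_ae ?_
          filter_upwards [hg1] with y hy
          refine le_trans ?_ (ENNReal.add_mul_rpow_le_of_add_le_one hq
            (enorm_half_add_add_enorm_half_sub_le_one hx hy) ‖F x‖ₑ ‖F y‖ₑ)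
          gcongr
          exact (enorm_add_le _ _).trans_eq (by rw [enorm_mul _ (F x), enorm_mul _ (F y)])
    _ = (∫⁻ x, ∫⁻ y, ‖2⁻¹ * (g x + g y)‖ₑ * ‖F x‖ₑ ^ q ∂μ ∂μ)
          + ∫⁻ x, ∫⁻ y, ‖2⁻¹ * (g x - g y)‖ₑ * ‖F y‖ₑ ^ q ∂μ ∂μ := by
        rw [← lintegral_add_left' hA.lintegral_prod_right']
        exact lintegral_congr fun x => lintegral_add_left' (hA_fst x) _
    _ = (∫⁻ x, ∫⁻ y, ‖2⁻¹ * (g x + g y)‖ₑ * ‖F x‖ₑ ^ q ∂μ ∂μ)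
          + ∫⁻ x, ∫⁻ y, ‖2⁻¹ * (g x - g y)‖ₑ * ‖F x‖ₑ ^ q ∂μ ∂μ := by
        congr 1
        rw [lintegral_lintegral_swap hB]
        refine lintegral_congr fun x => lintegral_congr fun y => ?_
        rw [enorm_mul, enorm_sub_rev, ← enorm_mul]
    _ = ∫⁻ x, ∫⁻ y, (‖2⁻¹ * (g x + g y)‖ₑ + ‖2⁻¹ * (g x - g y)‖ₑ) * ‖F x‖ₑ ^ q ∂μ ∂μ := by
        rw [← lintegral_add_left' hA.lintegral_prod_right']
        refine lintegral_congr fun x => ?_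
        rw [← lintegral_add_left' (hA_fst x)]
        simp_rw [add_mul]
    _ ≤ ∫⁻ x, ∫⁻ _, ‖F x‖ₑ ^ q ∂μ ∂μ := by
        refine lintegral_mono_ae ?_
        filter_upwards [hg1] with x hx
        refine lintegral_mono_ae ?_
        filter_upwards [hg1] with y hy
        exact mul_le_of_le_one_left' (enorm_half_add_add_enorm_half_sub_le_one hx hy)
    _ = ∫⁻ x, ‖F x‖ₑ ^ q ∂μ := by simp

/-- The symmetrized product with `g ∈ L^∞` acts on mean-zero functions with `L^p` norm at most
`‖g‖_∞`. -/
lemma eLpNorm_symmetrized_mul_le {S : Type*} [MeasurableSpace S] {μ : Measure S}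
    [IsProbabilityMeasure μ] {p : ℝ≥0∞} (hp1 : 1 ≤ p) (hp : p ≠ ∞) {F g : S → ℝ}
    (hF : Integrable F μ) (hF0 : ∫ x, F x ∂μ = 0) (hg : MemLp g ∞ μ) :
    eLpNorm (fun x => 2⁻¹ * (F x * g x + F x * ∫ y, g y ∂μ - ∫ y, F y * g y ∂μ)) p μ ≤
      eLpNorm g ∞ μ * eLpNorm F p μ := by
  set C : ℝ := (eLpNorm g ∞ μ).toReal with hC
  have hC0 : 0 ≤ C := ENNReal.toReal_nonneg
  have hCe : ‖C‖ₑ = eLpNorm g ∞ μ := by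
    rw [Real.enorm_eq_ofReal hC0, hC, ENNReal.ofReal_toReal hg.2.ne]
  have hgC : ∀ᵐ x ∂μ, ‖g x‖ ≤ C := by
    filter_upwards [enorm_ae_le_eLpNormEssSup g μ] with x hx
    rw [← eLpNorm_exponent_top, ← hCe] at hx
    simpa [abs_of_nonneg hC0] using enorm_le_iff_norm_le.mp hx
  have h1 : ∀ᵐ x ∂μ, ‖C⁻¹ * g x‖ ≤ 1 := by
    filter_upwards [hgC] with x hx
    rw [norm_mul, norm_inv, Real.norm_of_nonneg hC0]
    exact (mul_le_mul_of_nonneg_left hx (inv_nonneg.mpr hC0)).trans inv_mul_le_one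
  -- This also holds when `C = 0`: then `g` vanishes almost everywhere.
  have h2 : ∀ᵐ x ∂μ, g x = C * (C⁻¹ * g x) := by
    filter_upwards [hgC] with x hx
    rcases eq_or_ne C 0 with h | h
    · rw [h] at hx ⊢
      simpa using hx
    · rw [mul_inv_cancel_left₀ h]
  have e1 : ∫ y, g y ∂μ = C * ∫ y, C⁻¹ * g y ∂μ := by
    rw [← integral_const_mul]
    exact integral_congr_ae h2
  have e2 : ∫ y, F y * g y ∂μ = C * ∫ y, F y * (C⁻¹ * g y) ∂μ := by
    rw [← integral_const_mul]
    refine integral_congr_ae ?_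
    filter_upwards [h2] with y hy
    rw [mul_left_comm, ← hy]
  have e3 : (fun x => 2⁻¹ * (F x * g x + F x * ∫ y, g y ∂μ - ∫ y, F y * g y ∂μ)) =ᵐ[μ]
      C • fun x => 2⁻¹ * (F x * (C⁻¹ * g x) + F x * ∫ y, C⁻¹ * g y ∂μ
        - ∫ y, F y * (C⁻¹ * g y) ∂μ) := by
    filter_upwards [h2] with x hx
    rw [e1, e2, Pi.smul_apply, smul_eq_mul]
    linear_combination 2⁻¹ * F x * hx
  rw [eLpNorm_congr_ae e3, eLpNorm_const_smul, hCe]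
  gcongr
  exact eLpNorm_symmetrized_mul_le_of_norm_le_one hp1 hp hF hF0 (hg.1.const_mul _) h1

theorem theorem5p1 {S : Type*} [MeasurableSpace S] (μ : Measure S) [IsProbabilityMeasure μ]
    (p : ℝ≥0∞) (hp1 : 1 ≤ p) (hp : p ≠ ∞)
    (f g : S → ℝ) (hf : MemLp f ∞ μ) (hg : MemLp g ∞ μ) :
    eLpNorm (fun x => f x * g x - ∫ y, f y * g y ∂μ) p μ ≤
      eLpNorm g ∞ μ * eLpNorm (fun x => f x - ∫ y, f y ∂μ) p μ +
        eLpNorm f ∞ μ * eLpNorm (fun x => g x - ∫ y, g y ∂μ) p μ := by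
  have hfi : Integrable f μ := hf.integrable le_top
  have hgi : Integrable g μ := hg.integrable le_top
  have hfg : Integrable (fun y => f y * g y) μ := (hg.mul' hf (r := ∞)).integrable le_top
  have hF : Integrable (fun x => f x - ∫ y, f y ∂μ) μ := hfi.sub (integrable_const _)
  have hG : Integrable (fun x => g x - ∫ y, g y ∂μ) μ := hgi.sub (integrable_const _)
  have hF0 : ∫ x, (f x - ∫ y, f y ∂μ) ∂μ = 0 := by
    rw [integral_sub hfi (integrable_const _)]; simp
  have hG0 : ∫ x, (g x - ∫ y, g y ∂μ) ∂μ = 0 := by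
    rw [integral_sub hgi (integrable_const _)]; simp
  have eF : ∫ y, (f y - ∫ z, f z ∂μ) * g y ∂μ =
      ∫ y, f y * g y ∂μ - (∫ y, f y ∂μ) * ∫ y, g y ∂μ := by
    simp_rw [sub_mul]
    rw [integral_sub hfg (hgi.const_mul _), integral_const_mul]
  have eG : ∫ y, (g y - ∫ z, g z ∂μ) * f y ∂μ =
      ∫ y, f y * g y ∂μ - (∫ y, f y ∂μ) * ∫ y, g y ∂μ := by
    simp_rw [sub_mul, mul_comm (g _) (f _)]
    rw [integral_sub hfg (hfi.const_mul _), integral_const_mul, mul_comm (∫ y, g y ∂μ)]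
  have hsplit : (fun x => f x * g x - ∫ y, f y * g y ∂μ) =
      (fun x => 2⁻¹ * ((f x - ∫ y, f y ∂μ) * g x + (f x - ∫ y, f y ∂μ) * ∫ y, g y ∂μ
        - ∫ y, (f y - ∫ z, f z ∂μ) * g y ∂μ)) +
      fun x => 2⁻¹ * ((g x - ∫ y, g y ∂μ) * f x + (g x - ∫ y, g y ∂μ) * ∫ y, f y ∂μ
        - ∫ y, (g y - ∫ z, g z ∂μ) * f y ∂μ) := by
    ext x
    rw [Pi.add_apply, eF, eG]
    ring
  rw [hsplit]
  refine (eLpNorm_add_le ?_ ?_ hp1).trans (add_le_add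
    (eLpNorm_symmetrized_mul_le hp1 hp hF hF0 hg) (eLpNorm_symmetrized_mul_le hp1 hp hG hG0 hf))
  · exact (((hF.1.mul hg.1).add (hF.1.mul_const _)).sub aestronglyMeasurable_const).const_mul _
  · exact (((hG.1.mul hf.1).add (hG.1.mul_const _)).sub aestronglyMeasurable_const).const_mul _
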